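/- For $\sigma>0$ and $1\le p\le\infty$ let $B_\sigma^p$ denote the Bernstein space of all complex-valued functions $f\in L^p(\mathbb R)\cap C^\infty(\mathbb R)$ whose distributional Fourier transform $\mathcal F f$, given by $\langle \mathcal F f,\varphi\rangle=\int_{\mathbb R} f(x)\,(\mathcal F\varphi)(x)\,dx$ for Schwartz functions $\varphi$, where $\mathcal F\varphi(\xi)=\frac1{\sqrt{2\pi}}\int_{\mathbb R}\varphi(x)e^{-ix\xi}\,dx$, has support (in the sense of distributions) contained in $[-\sigma,\sigma]$. The space $B_\sigma^p$ is equipped with the norm $\|\cdot\|_p$ of $L^p(\mathbb R)$. (a) If $\sigma>0$, $1\le p\le\infty$, $f\in B_\sigma^p$, $h>0$ and $x_k=kh$ for $k\in\mathbb Z$, then $$\|f\|_p\;\le\;\sup_{x\in\mathbb R}\Big(h\sum_{k\in\mathbb Z}|f(x-x_k)|^p\Big)^{1/p}\;\le\;(1+h\sigma)\,\|f\|_p ,$$ where for $p=\infty$ the expression $\big(h\sum_{k}|f(x-x_k)|^p\big)^{1/p}$ is read as $\sup_{k\in\mathbb Z}|f(x-x_k)|$. (b) If $\sigma>0$ and $1\le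 p\le q\le\infty$, then $$B_\sigma^1\subset B_\sigma^p\subset B_\sigma^q\subset B_\sigma^\infty$$ and these embeddings are continuous: for each of the inclusions $B_\sigma^r\subset B_\sigma^s$ here there is a constant $C=C(\sigma,r,s)<\infty$ such that $\|f\|_s\le C\|f\|_r$ for all $f\in B_\sigma^r$. -/

import Mathlib

open MeasureTheory Set
open scoped ENNReal NNReal ContDiff SchwartzMap FourierTransform

/-- The Fourier transform with the unitary normalization in angular frequency,
`(1 / √(2π)) ∫ φ(x) e^{-i x ξ} dx`. -/
noncomputable def unitaryFourier (φ : ℝ → ℂ) (ξ : ℝ) : ℂ :=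
  (1 / (Real.sqrt (2 * Real.pi) : ℂ)) *
    ∫ x : ℝ, φ x * Complex.exp (-(Complex.I * (x : ℂ) * (ξ : ℂ)))

/-- Comparison with Mathlib's Fourier transform, whose kernel is `e^{-2π i x ξ}`. -/
theorem unitaryFourier_eq (φ : ℝ → ℂ) (ξ : ℝ) :
    unitaryFourier φ ξ =
      (1 / (Real.sqrt (2 * Real.pi) : ℂ)) * 𝓕 φ ((2 * Real.pi)⁻¹ * ξ) := by
  unfold unitaryFourier
  rw [Real.fourier_real_eq_integral_exp_smul]
  congr 1
  refine integral_congr_ae (Filter.Eventually.of_forall fun x => ?_)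
  have hpi : (Real.pi : ℂ) ≠ 0 := by exact_mod_cast Real.pi_ne_zero
  simp only [smul_eq_mul]
  rw [mul_comm]
  congr 2
  push_cast
  field_simp

/-- The Fourier transform of a Schwartz function lies in every `L^q`. -/
theorem memLp_unitaryFourier (φ : 𝓢(ℝ, ℂ)) (q : ℝ≥0∞) :
    MemLp (unitaryFourier φ) q volume := by
  have hc : (2 * Real.pi)⁻¹ ≠ 0 := inv_ne_zero Real.two_pi_pos.ne'
  let ψ : 𝓢(ℝ, ℂ) := SchwartzMap.compCLMOfContinuousLinearEquiv ℂ
    (ContinuousLinearEquiv.smulLeft (Units.mk0 _ hc) : ℝ ≃L[ℝ] ℝ) (𝓕 φ)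
  have h : unitaryFourier φ = fun ξ => (1 / (Real.sqrt (2 * Real.pi) : ℂ)) * ψ ξ := by
    funext ξ
    rw [unitaryFourier_eq]
    rfl
  rw [h]
  exact (ψ.memLp q).const_mul _

/-- The distributional Fourier transform of `f`, as a functional on Schwartz functions:
`⟨𝓕 f, φ⟩ = ⟨f, 𝓕 φ⟩ = ∫ f(x) (𝓕 φ)(x) dx`. -/
noncomputable def distFourier (f : ℝ → ℂ) (φ : 𝓢(ℝ, ℂ)) : ℂ :=
  ∫ x : ℝ, f x * unitaryFourier φ x

theorem integrable_mul_unitaryFourier {p : ℝ≥0∞} [Fact (1 ≤ p)] {f : ℝ → ℂ}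
    (hf : MemLp f p volume) (φ : 𝓢(ℝ, ℂ)) :
    Integrable (fun x => f x * unitaryFourier φ x) volume := by
  have : ENNReal.HolderConjugate p (ENNReal.conjExponent p) :=
    ENNReal.HolderConjugate.conjExponent Fact.out
  exact hf.integrable_mul (memLp_unitaryFourier φ (ENNReal.conjExponent p))

/-- The Bernstein space `B_σ^p`, `1 ≤ p ≤ ∞`: smooth functions `f : ℝ → ℂ` in `L^p(ℝ)` whose
distributional Fourier transform has its (distributional) support in `[-σ, σ]`.
Its norm is the `L^p` norm. -/
noncomputable def bernsteinSpace (σ : ℝ) (p : ℝ≥0∞) [Fact (1 ≤ p)] :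
    Submodule ℂ (ℝ → ℂ) where
  carrier := {f | ContDiff ℝ ∞ f ∧ MemLp f p volume ∧
    Distribution.dsupport (distFourier f) ⊆ Icc (-σ) σ}
  zero_mem' := by
    refine ⟨contDiff_const, MemLp.zero, fun x hx => ?_⟩
    rw [Distribution.mem_dsupport_iff_not_isVanishingOn] at hx
    refine absurd (fun φ _ => ?_) (hx univ (mem_univ x) isOpen_univ)
    simp [distFourier]
  add_mem' := by
    rintro f g ⟨hf, hfp, hfs⟩ ⟨hg, hgp, hgs⟩
    refine ⟨hf.add hg, hfp.add hgp, fun x hx => ?_⟩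
    by_contra hxs
    have h1 : x ∉ Distribution.dsupport (distFourier f) := fun h => hxs (hfs h)
    have h2 : x ∉ Distribution.dsupport (distFourier g) := fun h => hxs (hgs h)
    rw [Distribution.notMem_dsupport_iff] at h1 h2
    obtain ⟨s, hs, hso, hxs'⟩ := h1
    obtain ⟨t, ht, hto, hxt⟩ := h2
    rw [Distribution.mem_dsupport_iff_not_isVanishingOn] at hx
    refine hx (s ∩ t) ⟨hxs', hxt⟩ (hso.inter hto) fun φ hφ => ?_
    have e1 := hs φ (hφ.trans inter_subset_left)
    have e2 := ht φ (hφ.trans inter_subset_right)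
    have e : distFourier (f + g) φ = distFourier f φ + distFourier g φ := by
      unfold distFourier
      rw [← integral_add (integrable_mul_unitaryFourier hfp φ)
        (integrable_mul_unitaryFourier hgp φ)]
      simp only [Pi.add_apply, add_mul]
    rw [e, e1, e2, add_zero]
  smul_mem' := by
    rintro c f ⟨hf, hfp, hfs⟩
    refine ⟨hf.const_smul c, hfp.const_smul c, Subset.trans ?_ hfs⟩
    refine Distribution.dsupport_subset_dsupport fun s _ h φ hφ => ?_
    have e : distFourier (c • f) φ = c * distFourier f φ := by
      unfold distFourier
      rw [← integral_const_mul]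
      simp only [Pi.smul_apply, smul_eq_mul, mul_assoc]
    rw [e, h φ hφ, mul_zero]

/-- The discrete norm `(h ∑_k |a_k|^p)^{1/p}` with values in `[0, ∞]`, read as `sup_k |a_k|`
when `p = ∞`. -/
noncomputable def discreteNorm (h : ℝ) (p : ℝ≥0∞) (a : ℤ → ℂ) : ℝ≥0∞ :=
  if p = ⊤ then ⨆ k : ℤ, ‖a k‖ₑ
  else (ENNReal.ofReal h * ∑' k : ℤ, ‖a k‖ₑ ^ p.toReal) ^ (1 / p.toReal)

/-- `B_σ^p ⊂ B_σ^q`, and the inclusion, a linear map, is bounded for the `L^p` and `L^q` norms. -/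
def BernsteinEmbedding (σ : ℝ) (p q : ℝ≥0∞) [Fact (1 ≤ p)] [Fact (1 ≤ q)] : Prop :=
  bernsteinSpace σ p ≤ bernsteinSpace σ q ∧
    ∃ C : ℝ≥0, ∀ f ∈ bernsteinSpace σ p, eLpNorm f q volume ≤ C * eLpNorm f p volume

/-! For finite `p`, Tonelli turns `‖f‖_p^p` into the integral over one period `(0, h]` of the
sampled sums. Bounding these by their supremum gives the lower estimate in (a).

For the upper estimate, each `f (x - kh)` is compared with `f (x - kh - y)`, `0 < y ≤ h`, through
the integral of `f'` between them. Minkowski in `ℓ^p`, integration over `y` and Hölder bound the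
discrete norm by `‖f‖_p + h ‖f'‖_p` (`discreteNorm_le_add`). Bernstein's inequality `‖f'‖_p ≤ σ
‖f‖_p` (`eLpNorm_deriv_le`) finishes (a).

Bernstein's inequality follows M. Riesz: on `[-τ, τ]` the symbol `ξ` is a series `∑ c_k e^{-i a_k
ξ}` with `∑ |c_k| = τ`, obtained from a triangular wave (`exists_hasSum_exp`). If the spectrum lies
in `[-σ, σ]` with `σ < τ`, then `f' = i ∑ c_k f(· - a_k)`, so `‖f'‖_p ≤ τ ‖f‖_p`; now let `τ`
decrease to `σ`. As the transform of `f` is only a distribution, the identity is proved by duality,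
using that a tempered distribution kills every Schwartz function supported off its support
(`isVanishingOn_compl_dsupport`).

For (b), step `h = 1` in (a) bounds both `sup |f|` and `‖f‖_p` by `(1 + σ) ‖f‖_p`, and `L^p ∩ L^∞ ⊂
L^q`. -/

/-! ### Sampling estimates for a function and its derivative -/

theorem lintegral_eq_lintegral_Ioc_tsum {h : ℝ} (hh : 0 < h) {g : ℝ → ℝ≥0∞} (hg : Measurable g) :
    ∫⁻ x, g x = ∫⁻ x in Ioc 0 h, ∑' k : ℤ, g (x + k * h) := by
  have hm (k : ℤ) : Measurable fun x => g (x + k * h) := hg.comp (measurable_add_const _)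
  rw [lintegral_tsum fun k => (hm k).aemeasurable, ← setLIntegral_univ, ← iUnion_Ioc_add_zsmul hh 0,
    lintegral_iUnion (fun _ => measurableSet_Ioc) (pairwise_disjoint_Ioc_add_zsmul 0 h)]
  refine tsum_congr fun k => ?_
  rw [(measurePreserving_add_right volume ((k : ℝ) * h)).setLIntegral_comp_emb
    (measurableEmbedding_addRight _) g (Ioc 0 h)]
  congr 2
  simp only [image_add_const_Ioc, zsmul_eq_mul]
  push_cast
  congr 1; ring

theorem lintegral_eq_lintegral_Ioc_tsum_sub {h : ℝ} (hh : 0 < h) {g : ℝ → ℝ≥0∞}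
    (hg : Measurable g) (x : ℝ) :
    ∫⁻ y, g y = ∫⁻ y in Ioc 0 h, ∑' k : ℤ, g (x - k * h - y) := by
  have hm : Measurable fun y => g (x - y) := hg.comp (measurable_const.sub measurable_id)
  rw [← lintegral_sub_left_eq_self g x, lintegral_eq_lintegral_Ioc_tsum hh hm]
  refine lintegral_congr fun y => tsum_congr fun k => ?_
  congr 1; ring

theorem eLpNorm_rpow_eq_lintegral {p : ℝ≥0∞} (hp : 1 ≤ p) (hp' : p ≠ ⊤) (f : ℝ → ℂ) :
    eLpNorm f p volume ^ p.toReal = ∫⁻ x, ‖f x‖ₑ ^ p.toReal := by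
  have h0 : p.toReal ≠ 0 := (ENNReal.toReal_pos (by positivity) hp').ne'
  rw [eLpNorm_eq_lintegral_rpow_enorm_toReal (by positivity) hp', one_div,
    ENNReal.rpow_inv_rpow h0]

theorem eLpNorm_le_iSup_discreteNorm {p : ℝ≥0∞} (hp : 1 ≤ p) {h : ℝ} (hh : 0 < h) {f : ℝ → ℂ}
    (hf : Continuous f) :
    eLpNorm f p volume ≤ ⨆ x : ℝ, discreteNorm h p (fun k : ℤ => f (x - k * h)) := by
  by_cases hp' : p = ⊤
  · subst hp'
    simp only [discreteNorm, if_true]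
    rw [eLpNorm_exponent_top]
    refine essSup_le_of_ae_le _ (Filter.Eventually.of_forall fun x => ?_)
    refine le_iSup_of_le x (le_iSup_of_le (0 : ℤ) ?_)
    simp
  have hr : 0 < p.toReal := ENNReal.toReal_pos (by positivity) hp'
  set M := ⨆ x : ℝ, discreteNorm h p (fun k : ℤ => f (x - k * h))
  have hM (x : ℝ) : ENNReal.ofReal h * ∑' k : ℤ, ‖f (x - k * h)‖ₑ ^ p.toReal ≤ M ^ p.toReal := by
    have : discreteNorm h p (fun k : ℤ => f (x - k * h)) ≤ M :=
      le_iSup (fun x : ℝ => discreteNorm h p (fun k : ℤ => f (x - k * h))) x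
    rw [discreteNorm, if_neg hp', one_div, ENNReal.rpow_inv_le_iff hr] at this
    exact this
  rw [← ENNReal.rpow_le_rpow_iff hr, eLpNorm_rpow_eq_lintegral hp hp',
    lintegral_eq_lintegral_Ioc_tsum_sub hh (hf.measurable.enorm.pow_const _) 0]
  have hne : ENNReal.ofReal h ≠ 0 := by simpa using hh
  calc _ ≤ ∫⁻ y in Ioc 0 h, M ^ p.toReal / ENNReal.ofReal h := by
        refine lintegral_mono fun y => ?_
        rw [ENNReal.le_div_iff_mul_le (Or.inl hne) (Or.inl ENNReal.ofReal_ne_top), mul_comm]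
        convert! hM (-y) using 5
        ring_nf
    _ = _ := by
        rw [setLIntegral_const, Real.volume_Ioc, sub_zero,
          ENNReal.div_mul_cancel hne ENNReal.ofReal_ne_top]

theorem enorm_sub_le_lintegral_deriv {f : ℝ → ℂ} (hf : ContDiff ℝ 1 f) (z : ℝ) {h y : ℝ}
    (hy : y ∈ Ioc 0 h) : ‖f z - f (z - y)‖ₑ ≤ ∫⁻ u in Ioc 0 h, ‖deriv f (z - u)‖ₑ := by
  have hd : Continuous (deriv f) := hf.continuous_deriv le_rfl
  have e : f z - f (z - y) = ∫ u in Ioc 0 y, deriv f (z - u) := by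
    rw [← intervalIntegral.integral_of_le hy.1.le,
      intervalIntegral.integral_comp_sub_left (fun u => deriv f u) z, sub_zero,
      intervalIntegral.integral_deriv_eq_sub
        (fun x _ => (hf.differentiable one_ne_zero).differentiableAt)
        (hd.intervalIntegrable _ _)]
  rw [e]
  exact (enorm_integral_le_lintegral_enorm _).trans
    (lintegral_mono_set (Ioc_subset_Ioc_right hy.2))

/-- Hölder against the constant `1` on an interval of length `h`. -/
theorem lintegral_Ioc_rpow_le {h r : ℝ} (hr : 1 ≤ r) {g : ℝ → ℂ}
    (hg : Continuous g) :
    (∫⁻ u in Ioc 0 h, ‖g u‖ₑ) ^ r ≤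
      ENNReal.ofReal h ^ (r - 1) * ∫⁻ u in Ioc 0 h, ‖g u‖ₑ ^ r := by
  have hr0 : 0 < r := one_pos.trans_le hr
  have key := eLpNorm_le_eLpNorm_mul_rpow_measure_univ (μ := volume.restrict (Ioc 0 h))
    (p := 1) (q := ENNReal.ofReal r) (by simpa using hr)
    (hg.aestronglyMeasurable (μ := volume.restrict (Ioc 0 h)))
  rw [eLpNorm_one_eq_lintegral_enorm, eLpNorm_eq_lintegral_rpow_enorm_toReal
    (by simpa using hr0) (by simp), ENNReal.toReal_ofReal hr0.le] at key
  simp only [ENNReal.toReal_one, Measure.restrict_apply_univ, Real.volume_Ioc, sub_zero,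
    div_one] at key
  refine (ENNReal.rpow_le_rpow key hr0.le).trans ?_
  rw [ENNReal.mul_rpow_of_nonneg _ _ hr0.le, ← ENNReal.rpow_mul, ← ENNReal.rpow_mul,
    one_div_mul_cancel hr0.ne', ENNReal.rpow_one, mul_comm,
    show (1 - 1 / r) * r = r - 1 by field_simp]

theorem discreteNorm_le_add {p : ℝ≥0∞} (hp : 1 ≤ p) (hp' : p ≠ ⊤) {h : ℝ} (hh : 0 < h)
    {f : ℝ → ℂ} (hf : ContDiff ℝ 1 f) (x : ℝ) :
    discreteNorm h p (fun k : ℤ => f (x - k * h)) ≤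
      eLpNorm f p volume + ENNReal.ofReal h * eLpNorm (deriv f) p volume := by
  have hr1 : 1 ≤ p.toReal := by
    rw [← ENNReal.toReal_one]; exact ENNReal.toReal_mono hp' hp
  have hr : 0 < p.toReal := one_pos.trans_le hr1
  set r := p.toReal
  set H := ENNReal.ofReal h
  have hH : H ≠ 0 := by simpa [H] using hh
  have hH' : H ≠ ⊤ := ENNReal.ofReal_ne_top
  have hd : Continuous (deriv f) := hf.continuous_deriv le_rfl
  let b : ℤ → ℝ≥0∞ := fun k => ∫⁻ u in Ioc 0 h, ‖deriv f (x - k * h - u)‖ₑ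
  have hb : H * ∑' k, b k ^ r ≤ (H * eLpNorm (deriv f) p volume) ^ r := by
    have hm (k : ℤ) : Measurable fun y => ‖deriv f (x - k * h - y)‖ₑ ^ r :=
      (hd.comp (continuous_sub_left _)).measurable.enorm.pow_const _
    rw [ENNReal.mul_rpow_of_nonneg _ _ hr.le, eLpNorm_rpow_eq_lintegral hp hp',
      lintegral_eq_lintegral_Ioc_tsum_sub hh (hd.measurable.enorm.pow_const _) x,
      lintegral_tsum fun k => (hm k).aemeasurable]
    calc _ ≤ H * ∑' k : ℤ, H ^ (r - 1) * ∫⁻ u in Ioc 0 h, ‖deriv f (x - k * h - u)‖ₑ ^ r := by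
          gcongr with k
          exact lintegral_Ioc_rpow_le hr1 (hd.comp (continuous_sub_left _))
      _ = _ := by
          rw [ENNReal.tsum_mul_left, ← mul_assoc]
          congr 1
          nth_rw 1 [← ENNReal.rpow_one H]
          rw [← ENNReal.rpow_add _ _ hH hH']
          congr 1; ring
  -- Minkowski for counting measure on `ℤ`. The terms `b k` integrate over all of `(0, h]`, so they
  -- do not depend on `y`.
  have hmink (y : ℝ) (hy : y ∈ Ioc 0 h) :
      (∑' k : ℤ, ‖f (x - k * h)‖ₑ ^ r) ^ (1 / r) ≤
        (∑' k : ℤ, ‖f (x - k * h - y)‖ₑ ^ r) ^ (1 / r) + (∑' k, b k ^ r) ^ (1 / r) := by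
    have := ENNReal.lintegral_Lp_add_le (μ := Measure.count)
      (f := fun k : ℤ => ‖f (x - k * h - y)‖ₑ) (g := b) (measurable_of_countable _).aemeasurable
      (measurable_of_countable _).aemeasurable hr1
    simp only [lintegral_count] at this
    refine le_trans ?_ this
    gcongr with k
    calc _ = ‖f (x - k * h - y) + (f (x - k * h) - f (x - k * h - y))‖ₑ := by
          rw [add_sub_cancel]
      _ ≤ _ := (enorm_add_le _ _).trans
        (add_le_add le_rfl (enorm_sub_le_lintegral_deriv hf _ hy))
  set A := (∑' k : ℤ, ‖f (x - k * h)‖ₑ ^ r) ^ (1 / r)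
  set B := (∑' k, b k ^ r) ^ (1 / r)
  -- `A - B` is constant in `y`, so integrating over `(0, h]` yields the factor `H`. Truncated
  -- subtraction avoids a case split when `A < B`.
  have hAB : H * (A - B) ^ r ≤ eLpNorm f p volume ^ r := by
    rw [eLpNorm_rpow_eq_lintegral hp hp',
      lintegral_eq_lintegral_Ioc_tsum_sub hh (hf.continuous.measurable.enorm.pow_const _) x]
    calc _ = ∫⁻ y in Ioc 0 h, (A - B) ^ r := by
          rw [setLIntegral_const, Real.volume_Ioc, sub_zero, mul_comm]
      _ ≤ _ := by
          refine setLIntegral_mono' measurableSet_Ioc fun y hy => ?_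
          have := tsub_le_iff_right.2 (hmink y hy)
          rwa [one_div, ← one_div, one_div, ENNReal.le_rpow_inv_iff hr] at this
  have hroot (c : ℝ≥0∞) : (H * c) ^ (1 / r) = H ^ (1 / r) * c ^ (1 / r) :=
    ENNReal.mul_rpow_of_nonneg _ _ (by positivity)
  have hself (c : ℝ≥0∞) : (c ^ r) ^ (1 / r) = c := by
    rw [one_div, ENNReal.rpow_rpow_inv hr.ne']
  have h1 : H ^ (1 / r) * (A - B) ≤ eLpNorm f p volume := by
    have := ENNReal.rpow_le_rpow hAB (z := 1 / r) (by positivity)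
    rwa [hroot, hself, hself] at this
  have h2 : H ^ (1 / r) * B ≤ H * eLpNorm (deriv f) p volume := by
    have := ENNReal.rpow_le_rpow hb (z := 1 / r) (by positivity)
    rwa [hroot, hself] at this
  rw [discreteNorm, if_neg hp', hroot]
  calc H ^ (1 / r) * A ≤ H ^ (1 / r) * ((A - B) + B) := by gcongr; exact le_tsub_add
    _ = H ^ (1 / r) * (A - B) + H ^ (1 / r) * B := mul_add _ _ _
    _ ≤ _ := add_le_add h1 h2

/-- The bound holds on a conull set, which is dense, and by continuity that set is closed. -/
theorem enorm_le_eLpNorm_top {f : ℝ → ℂ} (hf : Continuous f) (x : ℝ) :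
    ‖f x‖ₑ ≤ eLpNorm f ⊤ volume := by
  have hae : ∀ᵐ y : ℝ, ‖f y‖ₑ ≤ eLpNorm f ⊤ volume := ae_le_eLpNormEssSup
  have hd : Dense {y : ℝ | ‖f y‖ₑ ≤ eLpNorm f ⊤ volume} := Measure.dense_of_ae hae
  have hc : IsClosed {y : ℝ | ‖f y‖ₑ ≤ eLpNorm f ⊤ volume} :=
    isClosed_le hf.enorm continuous_const
  have := hd.closure_eq
  rw [hc.closure_eq] at this
  exact this.ge (mem_univ x)

theorem iSup_discreteNorm_le {p : ℝ≥0∞} (hp : 1 ≤ p) {h σ : ℝ} (hh : 0 < h) (hσ : 0 < σ)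
    {f : ℝ → ℂ} (hf : ContDiff ℝ 1 f)
    (hB : p ≠ ⊤ → eLpNorm (deriv f) p volume ≤ ENNReal.ofReal σ * eLpNorm f p volume) :
    (⨆ x : ℝ, discreteNorm h p (fun k : ℤ => f (x - k * h))) ≤
      ENNReal.ofReal (1 + h * σ) * eLpNorm f p volume := by
  refine iSup_le fun x => ?_
  rw [ENNReal.ofReal_add zero_le_one (by positivity), ENNReal.ofReal_one, add_mul, one_mul,
    ENNReal.ofReal_mul hh.le, mul_assoc]
  by_cases hp' : p = ⊤
  · subst hp'
    rw [discreteNorm, if_pos rfl]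
    exact iSup_le fun k => (enorm_le_eLpNorm_top hf.continuous _).trans le_self_add
  · refine (discreteNorm_le_add hp hp' hh hf x).trans ?_
    gcongr
    exact hB hp'

/-! ### From a uniform bound to `L^q` -/

theorem enorm_le_iSup_discreteNorm_one {p : ℝ≥0∞} (hp : 1 ≤ p) (f : ℝ → ℂ) (x : ℝ) :
    ‖f x‖ₑ ≤ ⨆ x : ℝ, discreteNorm 1 p (fun k : ℤ => f (x - k * 1)) := by
  refine le_iSup_of_le x ?_
  rw [discreteNorm]
  split_ifs with hp'
  · exact le_iSup_of_le (0 : ℤ) (by simp)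
  · have hr : 0 < p.toReal := ENNReal.toReal_pos (by positivity) hp'
    rw [one_div, ENNReal.le_rpow_inv_iff hr, ENNReal.ofReal_one, one_mul]
    refine le_trans ?_ (ENNReal.le_tsum (0 : ℤ))
    simp

/-- Integrate `|f|^q ≤ M^(q-p) |f|^p`. -/
theorem eLpNorm_le_of_enorm_le {p q : ℝ≥0∞} (hp : 1 ≤ p) (hpq : p ≤ q) {f : ℝ → ℂ} {M : ℝ≥0∞}
    (hM : ∀ x, ‖f x‖ₑ ≤ M) (hpM : eLpNorm f p volume ≤ M) : eLpNorm f q volume ≤ M := by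
  by_cases hq : q = ⊤
  · subst hq
    exact essSup_le_of_ae_le _ (Filter.Eventually.of_forall hM)
  have hp' : p ≠ ⊤ := ne_top_of_le_ne_top hq hpq
  have hr : 0 < p.toReal := ENNReal.toReal_pos (by positivity) hp'
  have hrs : p.toReal ≤ q.toReal := ENNReal.toReal_mono hq hpq
  rw [← ENNReal.rpow_le_rpow_iff (hr.trans_le hrs), eLpNorm_rpow_eq_lintegral (hp.trans hpq) hq]
  have hs (c : ℝ≥0∞) : c ^ q.toReal = c ^ (q.toReal - p.toReal) * c ^ p.toReal := by
    rw [← ENNReal.rpow_add_of_nonneg _ _ (sub_nonneg.2 hrs) hr.le, sub_add_cancel]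
  by_cases hMt : M = ⊤
  · simp [hMt, hr.trans_le hrs]
  calc _ ≤ ∫⁻ x, M ^ (q.toReal - p.toReal) * ‖f x‖ₑ ^ p.toReal := by
        refine lintegral_mono fun x => ?_
        rw [hs]
        gcongr
        exact hM x
    _ = M ^ (q.toReal - p.toReal) * ∫⁻ x, ‖f x‖ₑ ^ p.toReal := by
        rw [lintegral_const_mul' _ _ (ENNReal.rpow_ne_top_of_nonneg (sub_nonneg.2 hrs) hMt)]
    _ ≤ _ := by
        rw [← eLpNorm_rpow_eq_lintegral hp hp', hs M]
        gcongr

/-! ### Expansion of `ξ` into exponentials -/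

/-- Fourier series of the Bernoulli polynomial `B₂`. The term `n = 0` vanishes because `1 / 0 = 0`.
-/
theorem hasSum_one_div_sq_mul_cos {x : ℝ} (hx : x ∈ Icc (0 : ℝ) 1) :
    HasSum (fun n : ℕ => 1 / (n : ℝ) ^ 2 * Real.cos (2 * Real.pi * n * x))
      (Real.pi ^ 2 * (x ^ 2 - x + 1 / 6)) := by
  have h := hasSum_one_div_nat_pow_mul_cos one_ne_zero hx
  have hB : (Polynomial.map (algebraMap ℚ ℝ) (Polynomial.bernoulli (2 * 1))).eval x =
      x ^ 2 - x + 1 / 6 := by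
    simp [Polynomial.bernoulli, Finset.sum_range_succ, bernoulli_two, bernoulli_one,
      Polynomial.eval_add, Polynomial.map_add]
    ring
  have hc : (-1 : ℝ) ^ (1 + 1) * (2 * Real.pi) ^ (2 * 1) / 2 / (2 * 1).factorial = Real.pi ^ 2 := by
    norm_num [Nat.factorial]
    ring
  rwa [hB, hc, mul_one] at h

/-- The cosine series of the triangular wave. -/
theorem hasSum_triangular_wave {α : ℝ} (hα : α ∈ Icc 0 Real.pi) :
    HasSum (fun n : ℕ => (1 - (-1) ^ n) / (2 * (n : ℝ) ^ 2) * Real.cos (n * α))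
      (Real.pi ^ 2 / 8 - Real.pi * α / 4) := by
  have hpi := Real.pi_pos
  have hx0 : 0 ≤ α / (2 * Real.pi) := div_nonneg hα.1 (by positivity)
  have hx1 : α / (2 * Real.pi) ≤ 1 / 2 := by
    rw [div_le_iff₀ (by positivity)]; linarith [hα.2]
  have h1 := hasSum_one_div_sq_mul_cos (x := α / (2 * Real.pi)) ⟨hx0, by linarith⟩
  -- A half-period shift multiplies the `n`th cosine by `(-1)^n`; subtracting leaves the odd
  -- frequencies and cancels the quadratic terms.
  have h2 := hasSum_one_div_sq_mul_cos (x := α / (2 * Real.pi) + 1 / 2)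
    ⟨by linarith, by linarith⟩
  convert! (h1.sub h2).mul_left (1 / 2) using 1
  · funext n
    have e1 : 2 * Real.pi * n * (α / (2 * Real.pi)) = n * α := by field_simp
    have e2 : 2 * Real.pi * n * (α / (2 * Real.pi) + 1 / 2) = n * α + n * Real.pi := by
      field_simp
    rw [e1, e2, Real.cos_add_nat_mul_pi]
    ring
  · field_simp
    ring

/-- On `[-τ, τ]` the function `ξ` is the sum of a series of exponentials whose coefficients have
absolute sum `τ`. -/
theorem exists_hasSum_exp {τ : ℝ} (hτ : 0 < τ) :
    ∃ (c : ℕ ⊕ ℕ → ℂ) (a : ℕ ⊕ ℕ → ℝ), HasSum (fun k => ‖c k‖) τ ∧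
      ∀ ξ ∈ Icc (-τ) τ,
        HasSum (fun k => c k * Complex.exp (-(Complex.I * (a k : ℂ) * (ξ : ℂ)))) ξ := by
  have hpi := Real.pi_pos
  -- Normalized so that the wave at `α = 0`, with value `π² / 8`, gives `∑ b n = τ / 2`; the
  -- frequencies `±n` together give `τ`.
  let b : ℕ → ℝ := fun n => 4 * τ / Real.pi ^ 2 * ((1 - (-1) ^ n) / (2 * (n : ℝ) ^ 2))
  have hb0 (n : ℕ) : 0 ≤ b n := by
    have : (0 : ℝ) ≤ 1 - (-1) ^ n := by
      rcases neg_one_pow_eq_or ℝ n with h | h <;> rw [h] <;> norm_num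
    positivity
  have hb : HasSum b (τ / 2) := by
    have := (hasSum_triangular_wave (α := 0) ⟨le_rfl, hpi.le⟩).mul_left (4 * τ / Real.pi ^ 2)
    convert! this using 1
    · funext n; simp [b]
    · field_simp; ring
  let u : ℝ → ℕ → ℂ := fun t n => b n * Complex.exp ((n * t : ℝ) * Complex.I)
  have hu (t : ℝ) (n : ℕ) : ‖u t n‖ = b n := by
    simp only [u]
    rw [norm_mul, Complex.norm_exp_ofReal_mul_I, mul_one, Complex.norm_real, Real.norm_eq_abs,
      abs_of_nonneg (hb0 n)]
  have hus (t : ℝ) : Summable (u t) := Summable.of_norm (by simpa only [hu] using hb.summable)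
  refine ⟨Sum.elim (u (Real.pi / 2)) (u (-(Real.pi / 2))),
    Sum.elim (fun n => n * (Real.pi / (2 * τ))) (fun n => -(n * (Real.pi / (2 * τ)))), ?_, ?_⟩
  · rw [← add_halves τ]
    refine HasSum.sum ?_ ?_ <;> simpa [Function.comp_def, hu] using hb
  · intro ξ hξ
    -- This substitution carries `[-τ, τ]` onto `[0, π]`, where the wave is affine. The phases
    -- `±nπ/2` go into the coefficients.
    let α : ℝ := Real.pi / 2 - Real.pi / (2 * τ) * ξ
    have hα : α ∈ Icc 0 Real.pi := by
      have e : Real.pi / (2 * τ) * ξ = Real.pi / 2 * (ξ / τ) := by field_simp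
      have h1 : ξ / τ ≤ 1 := (div_le_one hτ).2 hξ.2
      have h2 : -1 ≤ ξ / τ := by rw [le_div_iff₀ hτ]; linarith [hξ.1]
      simp only [α, e]
      constructor <;> nlinarith
    have hsum : (ξ : ℂ) = ∑' n, u α n + ∑' n, u (-α) n := by
      have h1 := ((hus α).hasSum.add (hus (-α)).hasSum)
      have h2 := Complex.hasSum_ofReal.2
        ((hasSum_triangular_wave hα).mul_left (8 * τ / Real.pi ^ 2))
      have hv : 8 * τ / Real.pi ^ 2 * (Real.pi ^ 2 / 8 - Real.pi * α / 4) = ξ := by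
        simp only [α]; field_simp; ring
      rw [hv] at h2
      refine h2.unique ?_
      convert! h1 using 1
      funext n
      simp only [u, b]
      push_cast
      rw [Complex.cos]
      have : -(n * (α : ℂ)) * Complex.I = n * (-(α : ℂ)) * Complex.I := by ring
      rw [this]
      ring
    suffices h : HasSum (fun k => (Sum.elim (u (Real.pi / 2)) (u (-(Real.pi / 2)))) k *
        Complex.exp (-(Complex.I * ((Sum.elim (fun n : ℕ => n * (Real.pi / (2 * τ)))
          (fun n : ℕ => -(n * (Real.pi / (2 * τ)))) k : ℝ) : ℂ) * (ξ : ℂ))))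
        (∑' n, u α n + ∑' n, u (-α) n) by
      rwa [← hsum] at h
    refine HasSum.sum ?_ ?_
    · convert! (hus α).hasSum using 1
      funext n
      simp only [Function.comp, Sum.elim_inl, u, α]
      rw [mul_assoc, ← Complex.exp_add]
      congr 2
      push_cast; ring
    · convert! (hus (-α)).hasSum using 1
      funext n
      simp only [Function.comp, Sum.elim_inr, u, α]
      rw [mul_assoc, ← Complex.exp_add]
      congr 2
      push_cast; ring

/-! ### Tempered distributions vanish off their support -/

theorem exists_norm_iteratedDeriv_le_of_hasCompactSupport {χ : ℝ → ℝ} (hχ : ContDiff ℝ ∞ χ)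
    (hc : HasCompactSupport χ) (i : ℕ) :
    ∃ M, ∀ x, ‖iteratedDeriv i (fun x => 1 - χ x) x‖ ≤ M := by
  have hcont : Continuous (iteratedFDeriv ℝ i χ) :=
    hχ.continuous_iteratedFDeriv (by exact_mod_cast le_top)
  obtain ⟨M, hM⟩ := (hc.iteratedFDeriv (𝕜 := ℝ) i).exists_bound_of_continuous hcont
  refine ⟨1 + M, fun x => ?_⟩
  rw [← norm_iteratedFDeriv_eq_norm_iteratedDeriv]
  have e := iteratedFDeriv_sub_apply (𝕜 := ℝ) (i := i) (x := x) (f := fun _ : ℝ => (1 : ℝ)) (g := χ)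
    contDiff_const.contDiffAt (hχ.of_le (by exact_mod_cast le_top)).contDiffAt
  change ‖iteratedFDeriv ℝ i ((fun _ : ℝ => (1 : ℝ)) - χ) x‖ ≤ _
  rw [e]
  refine (norm_sub_le _ _).trans (add_le_add ?_ (hM x))
  rcases i with _ | i
  · simp
  · rw [iteratedFDeriv_const_of_ne (Nat.succ_ne_zero i)]
    simp

/-- Compactly supported functions are dense in the Schwartz space, by cutting off with dilates of
a bump function. -/
theorem exists_tendsto_hasCompactSupport (φ : 𝓢(ℝ, ℂ)) :
    ∃ u : ℕ → 𝓢(ℝ, ℂ), (∀ N, HasCompactSupport (u N)) ∧ (∀ N, tsupport (u N) ⊆ tsupport φ) ∧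
      Filter.Tendsto u Filter.atTop (nhds φ) := by
  let χ : ContDiffBump (0 : ℝ) := ⟨1, 2, one_pos, one_lt_two⟩
  have hχ : ContDiff ℝ ∞ χ := χ.contDiff
  let r : ℕ → ℝ := fun N => 1 / ((N : ℝ) + 1)
  have hr (N : ℕ) : 0 < r N := Nat.one_div_pos_of_nat
  have hr1 (N : ℕ) : r N ≤ 1 := by
    simpa [r] using inv_le_one_of_one_le₀ (by linarith [N.cast_nonneg (α := ℝ)] : (1:ℝ) ≤ N + 1)
  let g : ℕ → ℝ → ℂ := fun N x => χ (r N * x) • φ x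
  have hgs (N : ℕ) : ContDiff ℝ ∞ (g N) :=
    (hχ.comp (contDiff_const.mul contDiff_id)).smul (φ.smooth ⊤)
  have hgc (N : ℕ) : HasCompactSupport (g N) := by
    have : HasCompactSupport fun x => χ (r N * x) :=
      χ.hasCompactSupport.comp_homeomorph (Homeomorph.mulLeft₀ (r N) (hr N).ne')
    exact this.smul_right
  let u : ℕ → 𝓢(ℝ, ℂ) := fun N => (hgc N).toSchwartzMap (hgs N)
  have hu (N : ℕ) (x : ℝ) : u N x = χ (r N * x) • φ x := rfl
  refine ⟨u, hgc, fun N => tsupport_smul_subset_right _ _, ?_⟩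
  choose M hM using exists_norm_iteratedDeriv_le_of_hasCompactSupport hχ χ.hasCompactSupport
  have hbound (k n : ℕ) : ∃ C, ∀ N, SchwartzMap.seminorm ℝ k n (u N - φ) ≤ r N * C := by
    refine ⟨∑ i ∈ Finset.range (n + 1),
      (n.choose i : ℝ) * M i * SchwartzMap.seminorm ℝ (k + 1) (n - i) φ, fun N => ?_⟩
    have hM0 (i : ℕ) : 0 ≤ M i := (norm_nonneg _).trans (hM i 0)
    have hC : 0 ≤ ∑ i ∈ Finset.range (n + 1),
        (n.choose i : ℝ) * M i * SchwartzMap.seminorm ℝ (k + 1) (n - i) φ :=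
      Finset.sum_nonneg fun i _ => mul_nonneg (mul_nonneg (by positivity) (hM0 i)) (by positivity)
    rw [← neg_sub, map_neg_eq_map]
    refine SchwartzMap.seminorm_le_bound ℝ k n _ (mul_nonneg (hr N).le hC) fun x => ?_
    have hfun : (φ - u N : 𝓢(ℝ, ℂ)) = fun x => (1 - χ (r N * x)) • φ x := by
      funext x
      simp [hu, sub_mul]
    rw [hfun]
    by_cases hx : |r N * x| < 1
    · have : (fun x => (1 - χ (r N * x)) • φ x) =ᶠ[nhds x] 0 := by
        have ho : IsOpen {y : ℝ | |r N * y| < 1} := isOpen_lt (by fun_prop) continuous_const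
        filter_upwards [ho.mem_nhds hx] with y hy
        have : χ (r N * y) = 1 := χ.one_of_mem_closedBall (by simpa using (le_of_lt hy))
        simp [this]
      rw [(this.iteratedFDeriv ℝ n).eq_of_nhds]
      simp only [iteratedFDeriv_zero, Pi.zero_apply, norm_zero, mul_zero]
      exact mul_nonneg (hr N).le hC
    · have hx' : 1 ≤ r N * |x| := by
        rw [not_lt, abs_mul, abs_of_pos (hr N)] at hx; exact hx
      have hη : ContDiff ℝ n (fun y => 1 - χ y) :=
        contDiff_const.sub (hχ.of_le (by exact_mod_cast le_top))
      have hη' : ContDiff ℝ n (fun y => 1 - χ (r N * y)) :=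
        hη.comp (contDiff_const.mul contDiff_id)
      have hder (i : ℕ) (hi : i ≤ n) :
          ‖iteratedFDeriv ℝ i (fun y => 1 - χ (r N * y)) x‖ ≤ M i := by
        rw [norm_iteratedFDeriv_eq_norm_iteratedDeriv,
          iteratedDeriv_comp_const_mul (f := fun y => 1 - χ y)
            (hη.of_le (by exact_mod_cast hi)), norm_mul, norm_pow,
          Real.norm_of_nonneg (hr N).le]
        exact (mul_le_of_le_one_left (norm_nonneg _) (pow_le_one₀ (hr N).le (hr1 N))).trans
          (hM i _)
      calc _ ≤ (r N * |x|) * (‖x‖ ^ k * ∑ i ∈ Finset.range (n + 1), (n.choose i : ℝ) *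
              ‖iteratedFDeriv ℝ i (fun y => 1 - χ (r N * y)) x‖ *
              ‖iteratedFDeriv ℝ (n - i) φ x‖) := by
            refine le_trans ?_ (le_mul_of_one_le_left (by positivity) hx')
            gcongr
            exact norm_iteratedFDeriv_smul_le hη' (φ.smooth n) x le_rfl
        _ = r N * ∑ i ∈ Finset.range (n + 1), (n.choose i : ℝ) *
              ‖iteratedFDeriv ℝ i (fun y => 1 - χ (r N * y)) x‖ *
              (‖x‖ ^ (k + 1) * ‖iteratedFDeriv ℝ (n - i) φ x‖) := by
            rw [mul_assoc, ← Real.norm_eq_abs x, ← mul_assoc ‖x‖, ← pow_succ', Finset.mul_sum]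
            congr 1
            refine Finset.sum_congr rfl fun i _ => by ring
        _ ≤ _ := by
            refine mul_le_mul_of_nonneg_left (Finset.sum_le_sum fun i hi => ?_) (hr N).le
            have hi' : i ≤ n := Nat.lt_succ_iff.1 (Finset.mem_range.1 hi)
            have := hM0 i
            have := hder i hi'
            have := SchwartzMap.le_seminorm ℝ (k + 1) (n - i) φ x
            gcongr
  rw [(schwartz_withSeminorms ℝ ℝ ℂ).tendsto_nhds]
  rintro ⟨k, n⟩ ε hε
  obtain ⟨C, hC⟩ := hbound k n
  have hlim : Filter.Tendsto (fun N => r N * C) Filter.atTop (nhds 0) := by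
    simpa [r] using (tendsto_one_div_add_atTop_nhds_zero_nat (𝕜 := ℝ)).mul_const C
  filter_upwards [hlim.eventually_lt_const hε] with N hN
  exact (hC N).trans_lt hN

/-- Finitely many vanishing sets cover the compact support; a subordinate smooth partition of unity
splits `φ` into pieces that `T` kills. -/
theorem eq_zero_of_hasCompactSupport_of_disjoint_dsupport {T : 𝓢(ℝ, ℂ) →L[ℂ] ℂ} {φ : 𝓢(ℝ, ℂ)}
    (hc : HasCompactSupport φ) (hφ : tsupport φ ⊆ (Distribution.dsupport T)ᶜ) : T φ = 0 := by
  have hloc (x : tsupport φ) : ∃ s : Set ℝ, Distribution.IsVanishingOn T s ∧ IsOpen s ∧ ↑x ∈ s :=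
    (Distribution.notMem_dsupport_iff _).1 (hφ x.2)
  choose s hs hso hxs using hloc
  obtain ⟨t, ht⟩ := hc.isCompact.elim_finite_subcover s hso
    fun x hx => mem_iUnion.2 ⟨⟨x, hx⟩, hxs _⟩
  obtain ⟨ρ, hρ⟩ := SmoothPartitionOfUnity.exists_isSubordinate (modelWithCornersSelf ℝ ℝ)
    (isClosed_tsupport φ) (fun i : t => s i) (fun i => hso i)
    (by simpa [iUnion_subtype] using ht)
  have hρs (i : t) : ContDiff ℝ ∞ (ρ i : ℝ → ℝ) := (ρ i).contMDiff.contDiff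
  have hsm (i : t) : ContDiff ℝ ∞ ((ρ i : ℝ → ℝ) • (φ : ℝ → ℂ)) := (hρs i).smul (φ.smooth ⊤)
  have hcs (i : t) : HasCompactSupport ((ρ i : ℝ → ℝ) • (φ : ℝ → ℂ)) := hc.smul_left
  let v : t → 𝓢(ℝ, ℂ) := fun i => (hcs i).toSchwartzMap (hsm i)
  have hsum : φ = ∑ i, v i := by
    ext x
    rw [sum_apply]
    change φ x = ∑ i, ρ i x • φ x
    rw [← Finset.sum_smul]
    by_cases hx : x ∈ tsupport φ
    · have := ρ.sum_eq_one hx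
      rw [finsum_eq_sum_of_fintype] at this
      rw [this, one_smul]
    · rw [image_eq_zero_of_notMem_tsupport hx, smul_zero]
  rw [hsum, map_sum]
  refine Finset.sum_eq_zero fun i _ => hs i _ ?_
  exact (tsupport_smul_subset_left _ _).trans (hρ i)

/-- Cutting off does not enlarge the support, so continuity of `T` extends the compactly supported
case. -/
theorem isVanishingOn_compl_dsupport (T : 𝓢(ℝ, ℂ) →L[ℂ] ℂ) :
    Distribution.IsVanishingOn T (Distribution.dsupport T)ᶜ := by
  intro φ hφ
  obtain ⟨u, huc, hus, hu⟩ := exists_tendsto_hasCompactSupport φ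
  refine tendsto_nhds_unique ((T.continuous.tendsto φ).comp hu) ?_
  refine tendsto_const_nhds.congr fun N => ?_
  exact (eq_zero_of_hasCompactSupport_of_disjoint_dsupport (huc N) ((hus N).trans hφ)).symm

/-! ### Fourier transform of Schwartz functions -/

/-- The unitary Fourier transform as an operator on the Schwartz space. -/
noncomputable def unitaryFourierCLM : 𝓢(ℝ, ℂ) →L[ℂ] 𝓢(ℝ, ℂ) :=
  (1 / (Real.sqrt (2 * Real.pi) : ℂ)) •
    ((SchwartzMap.compCLMOfContinuousLinearEquiv ℂ (ContinuousLinearEquiv.smulLeft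
      (Units.mk0 _ (inv_ne_zero Real.two_pi_pos.ne')) : ℝ ≃L[ℝ] ℝ)).comp
      (FourierTransform.fourierCLM ℂ 𝓢(ℝ, ℂ)))

@[simp]
theorem unitaryFourierCLM_apply (φ : 𝓢(ℝ, ℂ)) (x : ℝ) :
    unitaryFourierCLM φ x = unitaryFourier φ x := by
  rw [unitaryFourier_eq]
  rfl

theorem unitaryFourierCLM_surjective : Function.Surjective unitaryFourierCLM := by
  intro ψ
  have h2 := Real.two_pi_pos
  let e : ℝ ≃L[ℝ] ℝ := ContinuousLinearEquiv.smulLeft (Units.mk0 _ h2.ne')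
  let ψ' : 𝓢(ℝ, ℂ) := (Real.sqrt (2 * Real.pi) : ℂ) •
    SchwartzMap.compCLMOfContinuousLinearEquiv ℂ e ψ
  refine ⟨𝓕⁻ ψ', ?_⟩
  ext x
  rw [unitaryFourierCLM_apply, unitaryFourier_eq, ← SchwartzMap.fourier_coe,
    FourierTransform.fourier_fourierInv_eq]
  have hs : (Real.sqrt (2 * Real.pi) : ℂ) ≠ 0 := by
    exact_mod_cast (Real.sqrt_pos.2 h2).ne'
  have he : e ((2 * Real.pi)⁻¹ * x) = x := by
    change 2 * Real.pi * ((2 * Real.pi)⁻¹ * x) = x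
    field_simp
  simp only [ψ', smul_apply, SchwartzMap.compCLMOfContinuousLinearEquiv_apply,
    Function.comp, he, smul_eq_mul]
  field_simp

theorem hasTemperateGrowth_cexp_mul_I (a : ℝ) :
    Function.HasTemperateGrowth fun ξ : ℝ => Complex.exp (-(Complex.I * a * ξ)) := by
  have hd (n : ℕ) : iteratedDeriv n (fun ξ : ℝ => Complex.exp (-(Complex.I * a * ξ))) =
      fun ξ : ℝ => (-(Complex.I * a)) ^ n * Complex.exp (-(Complex.I * a * ξ)) := by
    induction n with
    | zero => simp
    | succ n ih =>
      rw [iteratedDeriv_succ, ih]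
      funext ξ
      have h0 : HasDerivAt (fun ξ : ℝ => -(Complex.I * a * (ξ : ℂ))) (-(Complex.I * a)) ξ := by
        simpa using ((Complex.ofRealCLM.hasDerivAt (x := ξ)).const_mul (Complex.I * a)).fun_neg
      rw [(h0.cexp.const_mul _).deriv]
      ring
  have hs : ContDiff ℝ ∞ fun ξ : ℝ => (ξ : ℂ) := Complex.ofRealCLM.contDiff
  refine ⟨(contDiff_const.mul hs).neg.cexp, fun n => ⟨0, |a| ^ n, fun ξ => ?_⟩⟩
  rw [norm_iteratedFDeriv_eq_norm_iteratedDeriv, hd, norm_mul, norm_pow,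
    show -(Complex.I * a * ξ) = ((-(a * ξ) : ℝ) : ℂ) * Complex.I by push_cast; ring,
    Complex.norm_exp_ofReal_mul_I]
  simp

/-- Translation after the transform is modulation before it, which does not enlarge the support. -/
theorem exists_unitaryFourier_add (φ : 𝓢(ℝ, ℂ)) (a : ℝ) :
    ∃ φ' : 𝓢(ℝ, ℂ), tsupport φ' ⊆ tsupport φ ∧
      ∀ x, unitaryFourier φ' x = unitaryFourier φ (x + a) := by
  refine ⟨SchwartzMap.smulLeftCLM ℂ (fun ξ : ℝ => Complex.exp (-(Complex.I * a * ξ))) φ,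
    (SchwartzMap.tsupport_smulLeftCLM_subset _ _).trans inter_subset_left, fun x => ?_⟩
  unfold unitaryFourier
  congr 1
  refine integral_congr_ae (Filter.Eventually.of_forall fun ξ => ?_)
  simp only [SchwartzMap.smulLeftCLM_apply_apply (hasTemperateGrowth_cexp_mul_I a), smul_eq_mul]
  rw [mul_comm (Complex.exp _), mul_assoc, ← Complex.exp_add]
  congr 2
  push_cast
  ring

theorem exists_unitaryFourier_eq_deriv (φ : 𝓢(ℝ, ℂ)) :
    ∃ φ' : 𝓢(ℝ, ℂ), (∀ ξ, φ' ξ = -(Complex.I * ξ) * φ ξ) ∧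
      ∀ x, deriv (unitaryFourier φ) x = unitaryFourier φ' x := by
  have hg : Function.HasTemperateGrowth fun ξ : ℝ => -(Complex.I * ξ) := by fun_prop
  have hφ' := SchwartzMap.smulLeftCLM_apply_apply hg φ
  set φ' := SchwartzMap.smulLeftCLM ℂ (fun ξ : ℝ => -(Complex.I * ξ)) φ
  refine ⟨φ', hφ', fun x => ?_⟩
  have hint : Integrable fun ξ : ℝ => ξ • φ ξ := by
    refine (φ'.integrable.const_mul Complex.I).congr (Filter.Eventually.of_forall fun ξ => ?_)
    simp only [hφ', smul_eq_mul, Complex.real_smul]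
    linear_combination (-(ξ : ℂ) * φ ξ) * Complex.I_mul_I
  have hd := Real.hasDerivAt_fourier φ.integrable hint ((2 * Real.pi)⁻¹ * x)
  have hd' := (hd.scomp x ((hasDerivAt_id x).const_mul (2 * Real.pi)⁻¹)).const_mul
    (1 / (Real.sqrt (2 * Real.pi) : ℂ))
  have hfun : unitaryFourier φ = fun x => (1 / (Real.sqrt (2 * Real.pi) : ℂ)) *
      (𝓕 (φ : ℝ → ℂ) ∘ HMul.hMul (2 * Real.pi)⁻¹) x := by
    funext y
    rw [unitaryFourier_eq]
    rfl
  rw [hfun, hd'.deriv, unitaryFourier_eq]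
  congr 1
  have e : (fun ξ : ℝ => (-2 * Real.pi * Complex.I * ξ) • φ ξ) =
      (2 * Real.pi : ℂ) • (φ' : ℝ → ℂ) := by
    funext ξ
    simp only [Pi.smul_apply, hφ', smul_eq_mul]
    ring
  rw [e, Real.fourier_eq, Real.fourier_eq]
  have hpi : (Real.pi : ℂ) ≠ 0 := by exact_mod_cast Real.pi_ne_zero
  simp only [Pi.smul_apply, mul_one, Complex.real_smul, smul_eq_mul]
  push_cast
  field_simp
  rw [← integral_const_mul]
  refine integral_congr_ae (Filter.Eventually.of_forall fun ξ => ?_)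
  simp only [Circle.smul_def, smul_eq_mul]
  ring

/-! ### Pairing `L^p` functions with Schwartz functions -/

theorem integral_norm_mul_le {p q : ℝ≥0∞} [ENNReal.HolderTriple p q 1] {f g : ℝ → ℂ}
    (hf : MemLp f p volume) (hg : MemLp g q volume) :
    ∫ x, ‖f x * g x‖ ≤ (eLpNorm f p volume * eLpNorm g q volume).toReal := by
  have key := eLpNorm_smul_le_mul_eLpNorm (p := p) (q := q) (r := 1) hg.1 hf.1
  have hm := hf.1.mul hg.1
  refine le_trans (le_of_eq ?_) (ENNReal.toReal_mono (ENNReal.mul_ne_top hf.2.ne hg.2.ne) key)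
  rw [eLpNorm_one_eq_lintegral_enorm]
  exact integral_norm_eq_lintegral_enorm hm

section Pairing

variable {p : ℝ≥0∞} [Fact (1 ≤ p)]

theorem exists_clm_integral_mul_schwartz (ψ : 𝓢(ℝ, ℂ)) :
    ∃ A : Lp ℂ p (volume : Measure ℝ) →L[ℂ] ℂ, ∀ F, A F = ∫ x, F x * ψ x := by
  have : ENNReal.HolderConjugate p (ENNReal.conjExponent p) :=
    ENNReal.HolderConjugate.conjExponent Fact.out
  have : Fact (1 ≤ ENNReal.conjExponent p) := ⟨this.symm.one_le⟩
  refine ⟨((ContinuousLinearMap.mul ℂ ℂ).lpPairing volume p (ENNReal.conjExponent p)).flip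
    (ψ.toLp (ENNReal.conjExponent p)), fun F => ?_⟩
  rw [ContinuousLinearMap.flip_apply, ContinuousLinearMap.lpPairing_eq_integral]
  refine integral_congr_ae ?_
  filter_upwards [ψ.coeFn_toLp (ENNReal.conjExponent p) volume] with x hx
  rw [hx, ContinuousLinearMap.mul_apply']

theorem exists_clm_schwartz_integral_mul {f : ℝ → ℂ} (hf : MemLp f p volume) :
    ∃ T : 𝓢(ℝ, ℂ) →L[ℂ] ℂ, ∀ ψ, T ψ = ∫ x, f x * ψ x := by
  have : ENNReal.HolderConjugate p (ENNReal.conjExponent p) :=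
    ENNReal.HolderConjugate.conjExponent Fact.out
  have : Fact (1 ≤ ENNReal.conjExponent p) := ⟨this.symm.one_le⟩
  refine ⟨((ContinuousLinearMap.mul ℂ ℂ).lpPairing volume p (ENNReal.conjExponent p)
    (hf.toLp f)).comp (SchwartzMap.toLpCLM ℂ ℂ (ENNReal.conjExponent p) volume), fun ψ => ?_⟩
  rw [ContinuousLinearMap.comp_apply, ContinuousLinearMap.lpPairing_eq_integral]
  refine integral_congr_ae ?_
  filter_upwards [ψ.coeFn_toLp (ENNReal.conjExponent p) volume, hf.coeFn_toLp] with x hx hx'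
  rw [SchwartzMap.toLpCLM_apply, hx, hx', ContinuousLinearMap.mul_apply']

theorem integrable_mul_schwartz {f : ℝ → ℂ} (hf : MemLp f p volume) (ψ : 𝓢(ℝ, ℂ)) :
    Integrable (fun x => f x * ψ x) volume := by
  have : ENNReal.HolderConjugate p (ENNReal.conjExponent p) :=
    ENNReal.HolderConjugate.conjExponent Fact.out
  exact hf.integrable_mul (ψ.memLp (ENNReal.conjExponent p))

theorem exists_integral_norm_mul_comp_add_le {f : ℝ → ℂ} (hf : MemLp f p volume)
    (ψ : 𝓢(ℝ, ℂ)) : ∃ K, ∀ a : ℝ, ∫ x, ‖f x * ψ (x + a)‖ ≤ K := by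
  have hpq : ENNReal.HolderConjugate p (ENNReal.conjExponent p) :=
    ENNReal.HolderConjugate.conjExponent Fact.out
  have hψ := ψ.memLp (ENNReal.conjExponent p) volume
  refine ⟨(eLpNorm f p volume * eLpNorm ψ (ENNReal.conjExponent p) volume).toReal, fun a => ?_⟩
  have hmp := measurePreserving_add_right (volume : Measure ℝ) a
  rw [← eLpNorm_comp_measurePreserving hψ.1 hmp]
  exact integral_norm_mul_le hf (hψ.comp_measurePreserving hmp)

/-- By Hölder, the integrals of `|f ψ(· + a)|` are bounded uniformly in `a`, so absolute summability
of `c` permits the interchange. -/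
theorem hasSum_integral_mul_translates {ι : Type*} [Countable ι] {f : ℝ → ℂ}
    (hf : MemLp f p volume) (ψ : 𝓢(ℝ, ℂ)) {c : ι → ℂ} (hc : Summable fun k => ‖c k‖)
    (a : ι → ℝ) :
    HasSum (fun k => c k * ∫ x, f x * ψ (x + a k)) (∫ x, f x * ∑' k, c k * ψ (x + a k)) := by
  obtain ⟨K, hK⟩ := exists_integral_norm_mul_comp_add_le hf ψ
  have hint (k : ι) : Integrable fun x => c k * (f x * ψ (x + a k)) := by
    have := integrable_mul_schwartz hf (SchwartzMap.compSubConstCLM ℂ (-a k) ψ)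
    simp only [SchwartzMap.compSubConstCLM_apply, sub_neg_eq_add] at this
    exact this.const_mul _
  have h := hasSum_integral_of_summable_integral_norm hint ?_
  · convert! h using 1
    · funext k
      rw [integral_const_mul]
    · refine integral_congr_ae (Filter.Eventually.of_forall fun x => ?_)
      simp only [← tsum_mul_left, mul_left_comm]
  · refine Summable.of_nonneg_of_le (fun k => by positivity) (fun k => ?_) (hc.mul_right K)
    simp only [norm_mul (c k), integral_const_mul]
    gcongr
    exact hK _

theorem integral_mul_unitaryFourier_eq_zero {f : ℝ → ℂ} (hf : MemLp f p volume) {s : Set ℝ}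
    (hs : Distribution.dsupport (distFourier f) ⊆ s) {φ : 𝓢(ℝ, ℂ)} (hφ : tsupport φ ⊆ sᶜ) :
    ∫ x, f x * unitaryFourier φ x = 0 := by
  obtain ⟨T, hT⟩ := exists_clm_schwartz_integral_mul hf
  have hT' : (distFourier f : 𝓢(ℝ, ℂ) → ℂ) = T.comp unitaryFourierCLM := by
    funext φ
    simp [hT, distFourier]
  rw [hT'] at hs
  have := isVanishingOn_compl_dsupport _ φ (hφ.trans (compl_subset_compl.2 hs))
  simpa [hT] using this

end Pairing

/-! ### Differentiation as a series of translations -/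

/-- If `ξ` is a sum of exponentials on `[-τ, τ]`, then differentiation of functions with spectrum
in `[-τ, τ]` is a sum of translations. -/
theorem hasSum_translates_unitaryFourier {ι : Type*} [Countable ι] {c : ι → ℂ}
    (hc : Summable fun k => ‖c k‖) {a : ι → ℝ} {τ : ℝ}
    (hca : ∀ ξ ∈ Icc (-τ) τ,
      HasSum (fun k => c k * Complex.exp (-(Complex.I * (a k : ℂ) * (ξ : ℂ)))) ξ)
    {φ : 𝓢(ℝ, ℂ)} (hφ : ∀ ξ ∉ Icc (-τ) τ, φ ξ = 0) (x : ℝ) :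
    HasSum (fun k => c k * unitaryFourier φ (x + a k))
      (Complex.I * deriv (unitaryFourier φ) x) := by
  obtain ⟨φ', hφ', hd⟩ := exists_unitaryFourier_eq_deriv φ
  rw [hd]
  have hnorm (y ξ : ℝ) : ‖Complex.exp (-(Complex.I * (ξ : ℂ) * (y : ℂ)))‖ = 1 := by
    rw [show -(Complex.I * ξ * y) = ((-(ξ * y) : ℝ) : ℂ) * Complex.I by push_cast; ring,
      Complex.norm_exp_ofReal_mul_I]
  have hint (k : ι) : Integrable fun ξ : ℝ =>
      c k * (φ ξ * Complex.exp (-(Complex.I * (ξ : ℂ) * ((x + a k : ℝ) : ℂ)))) := by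
    refine Integrable.const_mul ?_ _
    refine φ.integrable.mul_bdd (c := 1) (by fun_prop) ?_
    exact Filter.Eventually.of_forall fun ξ => (hnorm _ _).le
  have h := hasSum_integral_of_summable_integral_norm hint ?_
  · unfold unitaryFourier
    convert! h.mul_left (1 / (Real.sqrt (2 * Real.pi) : ℂ)) using 1
    · funext k
      rw [integral_const_mul]
      ring
    · rw [mul_left_comm, ← integral_const_mul]
      congr 1
      refine integral_congr_ae (Filter.Eventually.of_forall fun ξ => ?_)
      simp only [hφ']
      by_cases hξ : ξ ∈ Icc (-τ) τ
      · have := ((hca ξ hξ).mul_left (φ ξ * Complex.exp (-(Complex.I * ξ * x)))).tsum_eq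
        convert this.symm using 1
        · linear_combination (-φ ξ * Complex.exp (-(Complex.I * ξ * x)) * ξ) * Complex.I_mul_I
        · refine tsum_congr fun k => ?_
          have e : Complex.exp (-(Complex.I * ξ * ((x + a k : ℝ) : ℂ))) =
              Complex.exp (-(Complex.I * ξ * x)) * Complex.exp (-(Complex.I * a k * ξ)) := by
            rw [← Complex.exp_add]
            congr 1
            push_cast
            ring
          rw [e]
          ring
      · simp [hφ ξ hξ]
  · simp only [norm_mul, hnorm, mul_one, integral_const_mul]
    exact hc.mul_right _

/-- The gap `σ < τ` leaves room for a bump equal to `1` on a neighbourhood of `[-σ, σ]`, so that the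
closed support of the remainder misses that interval. -/
theorem exists_schwartz_add_eq {σ τ : ℝ} (hσ : 0 < σ) (hστ : σ < τ) (φ : 𝓢(ℝ, ℂ)) :
    ∃ φ₁ φ₂ : 𝓢(ℝ, ℂ), φ = φ₁ + φ₂ ∧ (∀ ξ ∉ Icc (-τ) τ, φ₁ ξ = 0) ∧
      tsupport φ₂ ⊆ (Icc (-σ) σ)ᶜ := by
  let χ : ContDiffBump (0 : ℝ) := ⟨(σ + τ) / 2, τ, by linarith, by linarith⟩
  have hsm : ContDiff ℝ ∞ ((χ : ℝ → ℝ) • (φ : ℝ → ℂ)) := χ.contDiff.smul (φ.smooth ⊤)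
  have hcs : HasCompactSupport ((χ : ℝ → ℝ) • (φ : ℝ → ℂ)) := χ.hasCompactSupport.smul_right
  let φ₁ : 𝓢(ℝ, ℂ) := hcs.toSchwartzMap hsm
  have hφ₁ (ξ : ℝ) : φ₁ ξ = χ ξ • φ ξ := rfl
  refine ⟨φ₁, φ - φ₁, (add_sub_cancel _ _).symm, fun ξ hξ => ?_, fun ξ hξ hξ' => ?_⟩
  · have : χ ξ = 0 := by
      refine χ.zero_of_le_dist ?_
      rw [dist_zero_right, Real.norm_eq_abs]
      by_contra h
      exact hξ (abs_le.1 (not_le.1 h).le)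
    rw [hφ₁, this, zero_smul]
  · refine notMem_tsupport_iff_eventuallyEq.2 ?_ hξ
    have hmem : ξ ∈ Metric.ball (0 : ℝ) ((σ + τ) / 2) := by
      rw [mem_ball_zero_iff, Real.norm_eq_abs]
      linarith [abs_le.2 hξ']
    filter_upwards [Metric.isOpen_ball.mem_nhds hmem] with y hy
    have : χ y = 1 := χ.one_of_mem_closedBall (Metric.ball_subset_closedBall hy)
    simp [hφ₁, this]

/-! ### Bernstein's inequality and the embeddings -/

section Bernstein

variable {p : ℝ≥0∞} [Fact (1 ≤ p)]

/-- Write `ψ` as the transform of `φ₁ + φ₂`. The series for `ξ` applies to `φ₁`; `φ₂`, its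
modulations and its multiple by `-iξ` are all killed by the transform of `f`. -/
theorem hasSum_integral_mul_schwartz {f : ℝ → ℂ} (hf : MemLp f p volume) {σ τ : ℝ} (hσ : 0 < σ)
    (hστ : σ < τ) (hs : Distribution.dsupport (distFourier f) ⊆ Icc (-σ) σ)
    {ι : Type*} [Countable ι] {c : ι → ℂ} (hc : Summable fun k => ‖c k‖) {a : ι → ℝ}
    (hca : ∀ ξ ∈ Icc (-τ) τ,
      HasSum (fun k => c k * Complex.exp (-(Complex.I * (a k : ℂ) * (ξ : ℂ)))) ξ)
    (ψ : 𝓢(ℝ, ℂ)) :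
    HasSum (fun k => c k * ∫ x, f x * ψ (x + a k)) (Complex.I * ∫ x, f x * deriv ψ x) := by
  obtain ⟨φ, rfl⟩ := unitaryFourierCLM_surjective ψ
  obtain ⟨φ₁, φ₂, rfl, h₁, h₂⟩ := exists_schwartz_add_eq hσ hστ φ
  set ψ₁ := unitaryFourierCLM φ₁ with hψ₁
  set ψ₂ := unitaryFourierCLM φ₂ with hψ₂
  have hψ₁' : (ψ₁ : ℝ → ℂ) = unitaryFourier φ₁ := funext (unitaryFourierCLM_apply φ₁)
  have hψ₂' : (ψ₂ : ℝ → ℂ) = unitaryFourier φ₂ := funext (unitaryFourierCLM_apply φ₂)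
  have hz (k : ι) : ∫ x, f x * ψ₂ (x + a k) = 0 := by
    obtain ⟨φ', hφ', hu⟩ := exists_unitaryFourier_add φ₂ (a k)
    simpa only [hψ₂', hu] using integral_mul_unitaryFourier_eq_zero hf hs (hφ'.trans h₂)
  have hz' : ∫ x, f x * deriv ψ₂ x = 0 := by
    obtain ⟨φ', hφ', hu⟩ := exists_unitaryFourier_eq_deriv φ₂
    have hsub : tsupport φ' ⊆ tsupport φ₂ := by
      have : (φ' : ℝ → ℂ) = (fun ξ : ℝ => -(Complex.I * ξ)) * (φ₂ : ℝ → ℂ) := funext hφ'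
      rw [this]
      exact tsupport_mul_subset_right
    simpa only [hψ₂', hu] using integral_mul_unitaryFourier_eq_zero hf hs (hsub.trans h₂)
  have hint (ψ : 𝓢(ℝ, ℂ)) (b : ℝ) : Integrable fun x => f x * ψ (x + b) := by
    simpa using integrable_mul_schwartz hf (SchwartzMap.compSubConstCLM ℂ (-b) ψ)
  have hint' (ψ : 𝓢(ℝ, ℂ)) : Integrable fun x => f x * deriv ψ x :=
    integrable_mul_schwartz hf (SchwartzMap.derivCLM ℂ ℂ ψ)
  have e (k : ι) : ∫ x, f x * (unitaryFourierCLM (φ₁ + φ₂)) (x + a k) =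
      ∫ x, f x * ψ₁ (x + a k) := by
    rw [← add_zero (∫ x, f x * ψ₁ (x + a k)), ← hz k,
      ← integral_add (hint ψ₁ (a k)) (hint ψ₂ (a k)), map_add]
    simp only [add_apply, mul_add, hψ₁, hψ₂]
  have e' : ∫ x, f x * deriv (unitaryFourierCLM (φ₁ + φ₂)) x = ∫ x, f x * deriv ψ₁ x := by
    rw [← add_zero (∫ x, f x * deriv ψ₁ x), ← hz', ← integral_add (hint' ψ₁) (hint' ψ₂), map_add]
    refine integral_congr_ae (Filter.Eventually.of_forall fun x => ?_)
    have : deriv (ψ₁ + ψ₂ : 𝓢(ℝ, ℂ)) x = deriv ψ₁ x + deriv ψ₂ x :=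
      deriv_add ψ₁.differentiableAt ψ₂.differentiableAt
    change f x * deriv (ψ₁ + ψ₂ : 𝓢(ℝ, ℂ)) x = _
    rw [this, mul_add]
  simp only [e, e']
  convert! hasSum_integral_mul_translates hf ψ₁ hc a using 1
  rw [← integral_const_mul]
  refine integral_congr_ae (Filter.Eventually.of_forall fun x => ?_)
  simp only [hψ₁', (hasSum_translates_unitaryFourier hc hca h₁ x).tsum_eq]
  ring

theorem integral_mul_deriv_schwartz {f : ℝ → ℂ} (hf : ContDiff ℝ 1 f) {ψ : 𝓢(ℝ, ℂ)}
    (hψ : HasCompactSupport ψ) : ∫ x, f x * deriv ψ x = -∫ x, deriv f x * ψ x := by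
  have hd : Continuous (deriv f) := hf.continuous_deriv le_rfl
  have hψd : Continuous (deriv ψ) := (ψ.smooth 1).continuous_deriv le_rfl
  refine integral_mul_deriv_eq_deriv_mul_of_integrable
    (fun x _ => (hf.differentiable one_ne_zero x).hasDerivAt) (fun x _ => ψ.hasDerivAt x) ?_ ?_ ?_
  · exact (hf.continuous.mul hψd).integrable_of_hasCompactSupport hψ.deriv.mul_left
  · exact (hd.mul ψ.continuous).integrable_of_hasCompactSupport hψ.mul_left
  · exact (hf.continuous.mul ψ.continuous).integrable_of_hasCompactSupport hψ.mul_left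

theorem eLpNorm_deriv_le_of_lt {f : ℝ → ℂ} (hf : MemLp f p volume) (hf1 : ContDiff ℝ 1 f)
    {σ τ : ℝ} (hσ : 0 < σ) (hστ : σ < τ)
    (hs : Distribution.dsupport (distFourier f) ⊆ Icc (-σ) σ) :
    eLpNorm (deriv f) p volume ≤ ENNReal.ofReal τ * eLpNorm f p volume := by
  obtain ⟨c, a, hc, hca⟩ := exists_hasSum_exp (hσ.trans hστ)
  have hmp (k : ℕ ⊕ ℕ) := measurePreserving_sub_right (volume : Measure ℝ) (a k)
  have hfk (k : ℕ ⊕ ℕ) : MemLp (fun x => f (x - a k)) p volume :=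
    hf.comp_measurePreserving (hmp k)
  let F : ℕ ⊕ ℕ → Lp ℂ p (volume : Measure ℝ) := fun k => c k • (hfk k).toLp
  have hFn (k : ℕ ⊕ ℕ) : ‖F k‖ = ‖c k‖ * (eLpNorm f p volume).toReal := by
    have : eLpNorm (fun x => f (x - a k)) p volume = eLpNorm f p volume :=
      eLpNorm_comp_measurePreserving (g := f) hf.1 (hmp k)
    rw [norm_smul, Lp.norm_toLp, this]
  have hsumn : HasSum (fun k => ‖F k‖) (τ * (eLpNorm f p volume).toReal) := by
    simpa only [hFn] using hc.mul_right _
  have hF : Summable F := Summable.of_norm hsumn.summable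
  set G := ∑' k, F k with hG
  have hGn : ‖G‖ ≤ τ * (eLpNorm f p volume).toReal :=
    (norm_tsum_le_tsum_norm hsumn.summable).trans hsumn.tsum_eq.le
  have hpair (ψ : 𝓢(ℝ, ℂ)) : ∫ x, G x * ψ x = Complex.I * ∫ x, f x * deriv ψ x := by
    obtain ⟨A, hA⟩ := exists_clm_integral_mul_schwartz (p := p) ψ
    have h1 := A.hasSum hF.hasSum
    rw [← hG, hA] at h1
    refine h1.unique ?_
    convert! hasSum_integral_mul_schwartz hf hσ hστ hs hc.summable hca ψ using 1
    funext k
    have hk : ∫ x, ((hfk k).toLp : ℝ → ℂ) x * ψ x = ∫ x, f (x - a k) * ψ (x - a k + a k) := by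
      refine integral_congr_ae ?_
      filter_upwards [(hfk k).coeFn_toLp] with x hx
      rw [hx, sub_add_cancel]
    rw [map_smul, hA, smul_eq_mul, hk,
      integral_sub_right_eq_self (fun x => f x * ψ (x + a k)) (a k)]
  -- Integrating by parts in `hpair` shows that `f'` and `i G` agree against all smooth compactly
  -- supported functions, hence almost everywhere.
  have hae : ∀ᵐ x, deriv f x = (Complex.I • (G : ℝ → ℂ)) x := by
    refine ae_eq_of_integral_contDiff_smul_eq
      (hf1.continuous_deriv le_rfl).locallyIntegrable
      (((Lp.memLp G).const_smul Complex.I).locallyIntegrable Fact.out) fun g hg hgc => ?_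
    have hg₁ : HasCompactSupport (Complex.ofRealCLM ∘ g) := hgc.comp_left rfl
    have hg₂ : ContDiff ℝ ∞ (Complex.ofRealCLM ∘ g) := Complex.ofRealCLM.contDiff.comp hg
    let ψ : 𝓢(ℝ, ℂ) := hg₁.toSchwartzMap hg₂
    have hψ (x : ℝ) : ψ x = (g x : ℂ) := rfl
    have h1 := integral_mul_deriv_schwartz hf1 (ψ := ψ) hg₁
    have h2 := hpair ψ
    simp only [Complex.real_smul, ← hψ, Pi.smul_apply, smul_eq_mul, mul_left_comm _ Complex.I,
      integral_const_mul]
    simp only [mul_comm (ψ _)]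
    rw [h2, h1]
    linear_combination (∫ x, deriv f x * ψ x) * Complex.I_mul_I
  rw [eLpNorm_congr_ae hae, eLpNorm_const_smul, enorm_eq_nnnorm, Complex.nnnorm_I,
    ENNReal.coe_one, one_mul, ← ENNReal.ofReal_toReal (Lp.memLp G).2.ne,
    ← ENNReal.ofReal_toReal hf.2.ne, ← ENNReal.ofReal_mul (hσ.trans hστ).le]
  exact ENNReal.ofReal_le_ofReal hGn

/-- **Bernstein's inequality** with the sharp constant. -/
theorem eLpNorm_deriv_le {f : ℝ → ℂ} {σ : ℝ} (hσ : 0 < σ) (hf : f ∈ bernsteinSpace σ p) :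
    eLpNorm (deriv f) p volume ≤ ENNReal.ofReal σ * eLpNorm f p volume := by
  obtain ⟨hf1, hfp, hs⟩ := hf
  have hc : Filter.Tendsto (fun τ => ENNReal.ofReal τ * eLpNorm f p volume) (nhdsWithin σ (Ioi σ))
      (nhds (ENNReal.ofReal σ * eLpNorm f p volume)) := by
    refine ENNReal.Tendsto.mul_const ?_ (Or.inr hfp.2.ne)
    exact (ENNReal.continuous_ofReal.tendsto σ).mono_left nhdsWithin_le_nhds
  refine ge_of_tendsto hc ?_
  filter_upwards [self_mem_nhdsWithin] with τ hτ
  exact eLpNorm_deriv_le_of_lt hfp (hf1.of_le (by exact_mod_cast le_top)) hσ hτ hs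

theorem bernstein_discreteNorm {σ h : ℝ} (hσ : 0 < σ) (hh : 0 < h) {f : ℝ → ℂ}
    (hf : f ∈ bernsteinSpace σ p) :
    eLpNorm f p volume ≤ (⨆ x : ℝ, discreteNorm h p (fun k : ℤ => f (x - k * h))) ∧
      (⨆ x : ℝ, discreteNorm h p (fun k : ℤ => f (x - k * h))) ≤
        ENNReal.ofReal (1 + h * σ) * eLpNorm f p volume :=
  ⟨eLpNorm_le_iSup_discreteNorm Fact.out hh hf.1.continuous,
    iSup_discreteNorm_le Fact.out hh hσ (hf.1.of_le (by exact_mod_cast le_top))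
      fun _ => eLpNorm_deriv_le hσ hf⟩

theorem bernsteinEmbedding_of_le {σ : ℝ} (hσ : 0 < σ) {q : ℝ≥0∞} [Fact (1 ≤ q)] (hpq : p ≤ q) :
    BernsteinEmbedding σ p q := by
  have key (f : ℝ → ℂ) (hf : f ∈ bernsteinSpace σ p) :
      eLpNorm f q volume ≤ ENNReal.ofReal (1 + 1 * σ) * eLpNorm f p volume := by
    obtain ⟨h1, h2⟩ := bernstein_discreteNorm hσ one_pos hf
    exact eLpNorm_le_of_enorm_le Fact.out hpq
      (fun x => (enorm_le_iSup_discreteNorm_one Fact.out f x).trans h2) (h1.trans h2)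
  refine ⟨fun f hf => ⟨hf.1, ⟨hf.2.1.1, (key f hf).trans_lt ?_⟩, hf.2.2⟩,
    Real.toNNReal (1 + 1 * σ), key⟩
  exact ENNReal.mul_lt_top ENNReal.ofReal_lt_top hf.2.1.2

end Bernstein

theorem mainTheorem8 (σ : ℝ) (hσ : 0 < σ) :
    (∀ (p : ℝ≥0∞) [Fact (1 ≤ p)] (h : ℝ), 0 < h → ∀ f ∈ bernsteinSpace σ p,
      eLpNorm f p volume ≤ (⨆ x : ℝ, discreteNorm h p (fun k : ℤ => f (x - k * h))) ∧
      (⨆ x : ℝ, discreteNorm h p (fun k : ℤ => f (x - k * h))) ≤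
        ENNReal.ofReal (1 + h * σ) * eLpNorm f p volume) ∧
    (∀ (p q : ℝ≥0∞) [Fact (1 ≤ p)] [Fact (1 ≤ q)], p ≤ q →
      BernsteinEmbedding σ 1 p ∧ BernsteinEmbedding σ p q ∧ BernsteinEmbedding σ q ⊤) :=
  ⟨fun _ _ _ hh _ hf => bernstein_discreteNorm hσ hh hf,
    fun _ _ hp _ hpq => ⟨bernsteinEmbedding_of_le hσ hp.out, bernsteinEmbedding_of_le hσ hpq,
      bernsteinEmbedding_of_le hσ le_top⟩⟩
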